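/- Let $d\ge 4$ be even. For a polytope $P$ let $\operatorname{vert}P$ denote its set of vertices. The combinatorial types $\tilde Q_m^d$ ($m\ge 0$) of $d$-dimensional polytopes with $m+d+1$ facets, together with sets of vertices $T_m^0,\dots,T_m^d$ (the *tips*, i.e. $T_m^i=\operatorname{vert}F_m^i\setminus\operatorname{vert}F_m^{i-1}$ for the flag of faces $F_m^j$ with vertex sets $\bigcup_{i\le j}T_m^i$) and a labelling of the facets by $[m+d+1]=\{1,\dots,m+d+1\}$, are defined inductively. * $\tilde Q_0^d$ is the $d$-simplex with vertices $v_1,\dots,v_{d+1}$, and $T_0^i=\{v_{i+1}\}$ for $0\le i\le d$. The facet opposite to $v_1$ has label $2$, the facet opposite to $v_2$ has label $1$, and the facet opposite to $v_j$ has label $j$ for $3\le j\le d+1$. * Given $\tilde Q_m^d$ (in any realization, again called $\tilde Q_m^d$), let $H=H_{m+1}$ be any oriented affine hyperplane that has all tips $T_m^i$ with $i$ even on its open positive side and all tips $T_m^i$ with $i$ odd on its open negative side. Then $\tilde Q_{m+1}^d$ is the combinatorial type of $\tilde Q_m^d\cap H^{\ge 0}$. For a set $S$ of vertices of $\tilde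 Q_m^d$ let $N(S)$ be the set of all vertices of $\tilde Q_m^d\cap H^{\ge0}$ that lie in $\operatorname{conv}(S)\cap H$. Put $$T_{m+1}^0=N(T_m^1\cup T_m^2),\qquad T_{m+1}^1=N(T_m^0\cup T_m^1),$$ $$T_{m+1}^j=N\Bigl(T_m^{j+1}\cup\bigcup_{0\le k\le j,\ k\equiv j\ (\mathrm{mod}\ 2)}T_m^k\Bigr)\quad(2\le j\le d-1),\qquad T_{m+1}^d=\bigcup_{0\le k\le d/2}T_m^{2k}.$$ The new facet $\tilde Q_m^d\cap H$ gets the label $m+d+2$, and the other facets keep their labels. Identify each vertex $v$ of $\tilde Q_m^d$ with the set of labels of the facets incident to $v$. **Proposition 3.7.** Let $m\ge 0$ and $n=m+d+1$, and let $0\le i\le d$. A vertex $v$ of $\tilde Q_m^d$ lies in $T_m^i$ if and only if $$\max([n]\setminus v)=\begin{cases} m+2 & \text{for } i=0,\\ m+1 & \text{for } i=1,\\ m+i+1 & \text{for } 2\le i\le d.\end{cases}$$ -/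

import Mathlib

/-- The ambient space of `d`-dimensional polytopes. -/
abbrev Space (d : ℕ) : Type := EuclideanSpace ℝ (Fin d)

/-- A convex polytope: the convex hull of finitely many points. -/
def IsPolytope {d : ℕ} (P : Set (Space d)) : Prop :=
  ∃ s : Set (Space d), s.Finite ∧ P = convexHull ℝ s

/-- The vertices of a polytope are its extreme points. -/
def vert {d : ℕ} (P : Set (Space d)) : Set (Space d) := P.extremePoints ℝ

/-- The faces of `P` (including `∅` and `P` itself): the sets of maximizers over `P` of linear
functionals, and `∅`. -/
def IsFace {d : ℕ} (P F : Set (Space d)) : Prop := IsExposed ℝ P F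

/-- A set of vertices of `P` is facial if it is the set of all vertices of some face of `P`. -/
def IsFacial {d : ℕ} (P : Set (Space d)) (S : Set (vert P)) : Prop :=
  ∃ F, IsFace P F ∧ S = {v | (v : Space d) ∈ F}

/-- An oriented affine hyperplane `H = {f = 0}`, given by a non-constant affine functional `f`. -/
structure OrientedHyperplane (d : ℕ) where
  functional : Space d →ᵃ[ℝ] ℝ
  nonconstant : functional.linear ≠ 0

namespace OrientedHyperplane

variable {d : ℕ} (H : OrientedHyperplane d)

/-- The hyperplane itself. -/
def plane : Set (Space d) := {x | H.functional x = 0}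

/-- The open positive side `H⁺`. -/
def pos : Set (Space d) := {x | 0 < H.functional x}

/-- The open negative side `H⁻`. -/
def neg : Set (Space d) := {x | H.functional x < 0}

/-- The closed positive side. -/
def nonneg : Set (Space d) := {x | 0 ≤ H.functional x}

end OrientedHyperplane

/-- A subset of `ℝ^d` with tips `T^0, …, T^d` (sets of points, indices beyond `d` are irrelevant)
and with labelled facets (the facet with label `k` is `facet k`; when there are `n` facets, only
the labels `1, …, n` are relevant). -/
structure TippedPolytope (d : ℕ) where
  carrier : Set (Space d)
  tip : ℕ → Set (Space d)
  facet : ℕ → Set (Space d)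

namespace TippedPolytope

variable {d : ℕ}

/-- The label `λ(v) ⊆ {1, …, n}` of a point `v`: the labels of all facets incident to `v`. -/
def label (Q : TippedPolytope d) (n : ℕ) (v : Space d) : Set ℕ :=
  {k | k ∈ Set.Icc 1 n ∧ v ∈ Q.facet k}

/-- The union of all even tips. -/
def evenPart (Q : TippedPolytope d) : Set (Space d) := ⋃ i ∈ {i : ℕ | i ≤ d ∧ Even i}, Q.tip i

/-- The union of all odd tips. -/
def oddPart (Q : TippedPolytope d) : Set (Space d) := ⋃ i ∈ {i : ℕ | i ≤ d ∧ Odd i}, Q.tip i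

/-- The simplex on `v_1, …, v_{d+1}` (here `v_{i+1}` is `v i` for `i = 0, …, d`). The flag
`conv {v_1} ⊂ conv {v_1, v_2} ⊂ …` has the tips `T^i = {v_{i+1}}`. The facets are labelled such that
`v_1` misses exactly the facet `2`, `v_2` misses exactly the facet `1`, and `v_j` misses exactly the
facet `j` for `3 ≤ j ≤ d + 1`. -/
def simplex (v : Fin (d + 1) → Space d) : TippedPolytope d where
  carrier := convexHull ℝ (Set.range v)
  tip i := {x | ∃ h : i < d + 1, x = v ⟨i, h⟩}
  facet k := convexHull ℝ (v '' {i | Equiv.swap 1 2 ((i : ℕ) + 1) ≠ k})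

/-- The oriented hyperplane `H` has all even tips on its positive and all odd tips on its negative
side. (When every vertex lies in some tip, `H` is thus in general position: it contains no
vertex.) -/
def Separates (Q : TippedPolytope d) (H : OrientedHyperplane d) : Prop :=
  Q.evenPart ⊆ H.pos ∧ Q.oddPart ⊆ H.neg

/-- The polytope obtained from `Q` by cutting off the negative side of `H`. -/
def cutCarrier (Q : TippedPolytope d) (H : OrientedHyperplane d) : Set (Space d) :=
  Q.carrier ∩ H.nonneg

/-- The vertices of the cut polytope that lie on `H` and in the convex hull of `S`. When `S` is a set
of vertices of `Q`, and `H` avoids all vertices of `Q`, these are the intersections of `H` with the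
edges of `Q` that have both end points in `S`. -/
def newVertices (Q : TippedPolytope d) (H : OrientedHyperplane d) (S : Set (Space d)) :
    Set (Space d) :=
  {x | x ∈ vert (Q.cutCarrier H) ∧ x ∈ convexHull ℝ S ∩ H.plane}

/-- The tips after the cut. -/
def cutTip (Q : TippedPolytope d) (H : OrientedHyperplane d) (j : ℕ) : Set (Space d) :=
  if j = 0 then Q.newVertices H (Q.tip 1 ∪ Q.tip 2)
  else if j = 1 then Q.newVertices H (Q.tip 0 ∪ Q.tip 1)
  else if j < d then
    Q.newVertices H (Q.tip (j + 1) ∪ ⋃ k ∈ {k : ℕ | k ≤ j ∧ Even (k + j)}, Q.tip k)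
  else if j = d then ⋃ k ∈ {k : ℕ | k ≤ d / 2}, Q.tip (2 * k)
  else ∅

/-- One step of the construction, from a polytope with `n` facets to one with `n + 1` facets. The new
facet `Q ∩ H` gets the label `n + 1`, and the other facets keep their labels. -/
def cut (n : ℕ) (Q : TippedPolytope d) (H : OrientedHyperplane d) : TippedPolytope d where
  carrier := Q.cutCarrier H
  tip := Q.cutTip H
  facet k := if k = n + 1 then Q.carrier ∩ H.plane else Q.facet k ∩ Q.cutCarrier H

/-- `Q'` is another realization of the combinatorial type of `Q`, with the same tips and the same
labels of the `n` facets: there is a bijection `φ` between the vertices that maps the vertex sets of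
faces to the vertex sets of faces, in both directions, and respects the tips and the labelled
facets. -/
structure SameType (n : ℕ) (Q Q' : TippedPolytope d) (φ : vert Q.carrier ≃ vert Q'.carrier) :
    Prop where
  polytope : IsPolytope Q'.carrier
  facial_iff : ∀ S : Set (vert Q.carrier),
    IsFacial Q.carrier S ↔ IsFacial Q'.carrier (φ '' S)
  tip_subset : ∀ i ≤ d, Q'.tip i ⊆ vert Q'.carrier
  tip_iff : ∀ i ≤ d, ∀ v, (φ v : Space d) ∈ Q'.tip i ↔ (v : Space d) ∈ Q.tip i
  facet_face : ∀ k ∈ Set.Icc 1 n, IsFace Q'.carrier (Q'.facet k)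
  facet_iff : ∀ k ∈ Set.Icc 1 n, ∀ v,
    (φ v : Space d) ∈ Q'.facet k ↔ (v : Space d) ∈ Q.facet k

/-- `Realizes m Q` says that `Q` is a realization of the `m`-th combinatorial type of the family, with
its tips and facet labels; it has `n = m + d + 1` facets. The family starts with the `d`-simplex;
the next type is obtained by cutting any realization of the present one with any
oriented hyperplane that has the even tips on its positive and the odd tips on its negative side. -/
inductive Realizes : ℕ → TippedPolytope d → Prop
  | simplex (v : Fin (d + 1) → Space d) (hv : AffineIndependent ℝ v) :
      Realizes 0 (simplex v)
  | cut (m : ℕ) (Q : TippedPolytope d) (H : OrientedHyperplane d)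
      (hQ : Realizes m Q) (hH : Q.Separates H) : Realizes (m + 1) (cut (m + d + 1) Q H)
  | sameType (m : ℕ) (Q Q' : TippedPolytope d) (φ : vert Q.carrier ≃ vert Q'.carrier)
      (hQ : Realizes m Q) (hφ : SameType (m + d + 1) Q Q' φ) : Realizes m Q'

end TippedPolytope

/-! ### Extreme points of halfspace sections of convex sets. -/

section HalfspaceCut

variable {E : Type*} [AddCommGroup E] [Module ℝ E]

/-! The prescribed maximum is an injective function of `i`, so the equivalence follows from two
facts, carried through the construction by the invariant `Regular`: every vertex lies in some tip,
and every point of tip `i` has the prescribed largest missing label.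

In a cut, a surviving vertex is off the hyperplane, so it misses the newest label, the largest one
available; the surviving vertices form the last tip. A vertex on the hyperplane lies strictly
between a vertex `u` of an even tip and a vertex `v` of an odd tip. Facets are convex and extreme,
so it lies on an old facet exactly when `u` and `v` both do. Its missing labels are thus the union
of theirs, and the largest is the maximum of two known values
(`Regular.missing_of_mem_openSegment`). What remains is arithmetic: the parities and the larger
index determine the new tip (`max_maxMissing`, `exists_tipIndices`). It is never needed that `u` and
`v` span an edge. -/

theorem AffineMap.map_sum_smul_of_sum_eq_one {ι : Type*} (f : E →ᵃ[ℝ] ℝ) (s : Finset ι) (w : ι → ℝ)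
    (z : ι → E) (hw : ∑ i ∈ s, w i = 1) : f (∑ i ∈ s, w i • z i) = ∑ i ∈ s, w i * f (z i) := by
  have key : ∀ y, f y = f.linear y + f 0 := fun y => congrFun f.decomp y
  rw [key, map_sum, ← one_mul (f 0), ← hw, Finset.sum_mul, ← Finset.sum_add_distrib]
  refine Finset.sum_congr rfl fun i _ => ?_
  rw [key (z i), map_smul, smul_eq_mul, mul_add]

theorem exists_pos_weight_pos_value {ι : Type*} [Fintype ι] {w a : ι → ℝ} (hw : ∀ i, 0 ≤ w i)
    (hw1 : ∑ i, w i = 1) (ha : ∀ i, a i ≠ 0) (h : ∑ i, w i * a i = 0) :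
    ∃ i, 0 < w i ∧ 0 < a i := by
  by_contra! hc
  have hle : ∀ i ∈ Finset.univ, w i * a i ≤ 0 := fun i _ => by
    rcases (hw i).eq_or_lt with h0 | h0
    · simp [← h0]
    · exact mul_nonpos_of_nonneg_of_nonpos (hw i) (hc i h0)
  have h0 := (Finset.sum_eq_zero_iff_of_nonpos hle).1 h
  have : ∑ i, w i = 0 := Finset.sum_eq_zero fun i hi =>
    (mul_eq_zero.1 (h0 i hi)).resolve_right (ha i)
  linarith

/-- A vertex of a halfspace section of a convex set that lies on the bounding hyperplane and is a
convex combination of points off the hyperplane lies between two of these points. -/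
theorem exists_mem_openSegment_of_mem_extremePoints_inter {P S : Set E} (hP : Convex ℝ P)
    (hSP : S ⊆ P) (f : E →ᵃ[ℝ] ℝ) (hS : ∀ y ∈ S, f y ≠ 0) {x : E}
    (hx : x ∈ (P ∩ {y | 0 ≤ f y}).extremePoints ℝ) (hfx : f x = 0) (hxS : x ∈ convexHull ℝ S) :
    ∃ u ∈ S, ∃ v ∈ S, 0 < f u ∧ f v < 0 ∧ x ∈ openSegment ℝ u v := by
  classical
  obtain ⟨ι, _, w, z, hw, hw1, hz, rfl⟩ := mem_convexHull_iff_exists_fintype.1 hxS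
  have hsum := hfx
  rw [f.map_sum_smul_of_sum_eq_one _ _ _ hw1] at hsum
  obtain ⟨i, hwi, hi⟩ := exists_pos_weight_pos_value hw hw1 (fun i => hS _ (hz i)) hsum
  obtain ⟨j, hwj, hj⟩ := exists_pos_weight_pos_value (a := fun i => -f (z i)) hw hw1
    (fun i => neg_ne_zero.2 (hS _ (hz i))) (by simp [hsum])
  replace hj : f (z j) < 0 := by simpa using hj
  refine ⟨z i, hz i, z j, hz j, hi, hj, ?_⟩
  have hij : i ≠ j := by rintro rfl; linarith
  -- These weights make `y = α • z i + β • z j` the point where the segment crosses the hyperplane.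
  -- Splitting `x` as a combination of `y` and another point of the section forces `x = y` by
  -- extremality.
  set α := -f (z j) / (f (z i) - f (z j)) with hα
  set β := f (z i) / (f (z i) - f (z j)) with hβ
  have hd : 0 < f (z i) - f (z j) := by linarith
  have hα0 : 0 < α := div_pos (by linarith) hd
  have hβ0 : 0 < β := div_pos hi hd
  have hαβ : α + β = 1 := by rw [hα, hβ, ← add_div, div_eq_one_iff_eq hd.ne']; ring
  have hwle : ∀ k, w k ≤ 1 := fun k => hw1 ▸ Finset.single_le_sum (fun k _ => hw k) (Finset.mem_univ k)
  -- Halving ensures `ε < 1`, so that both coefficients of the splitting are positive.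
  set ε := min (w i) (w j) / 2 with hε
  have hε0 : 0 < ε := by positivity
  have hεi : ε ≤ w i := by have := min_le_left (w i) (w j); linarith
  have hεj : ε ≤ w j := by have := min_le_right (w i) (w j); linarith
  have hε1 : ε < 1 := by have := min_le_left (w i) (w j); have := hwle i; linarith
  set y := α • z i + β • z j with hy
  have hfy : f y = 0 := by
    rw [hy, Convex.combo_affine_apply hαβ, hα, hβ]
    simp only [smul_eq_mul]
    field_simp
    ring
  have hyP : y ∈ P := hP (hSP (hz i)) (hSP (hz j)) hα0.le hβ0.le hαβ
  -- The weights left after removing `ε • y`, renormalized; they are nonnegative because `α, β ≤ 1`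
  -- and `ε ≤ w i, w j`.
  set w' : ι → ℝ := fun k =>
    (1 - ε)⁻¹ * (w k - ε * ((if k = i then α else 0) + if k = j then β else 0)) with hw'
  set y' := ∑ k, w' k • z k with hy'
  have hw'0 : ∀ k, 0 ≤ w' k := by
    intro k
    refine mul_nonneg (inv_nonneg.2 (by linarith)) ?_
    by_cases hki : k = i
    · subst hki
      simp only [if_true, if_neg hij]
      nlinarith
    · by_cases hkj : k = j
      · subst hkj
        simp only [if_true, if_neg hki]
        nlinarith
      · simp [hki, hkj, hw k]
  have hne : (1 - ε) ≠ 0 := by linarith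
  have hw'1 : ∑ k, w' k = 1 := by
    rw [hw', ← Finset.mul_sum, Finset.sum_sub_distrib, ← Finset.mul_sum, Finset.sum_add_distrib]
    simp [hαβ, hw1, hne]
  have hy'P : y' ∈ P := hP.sum_mem (fun k _ => hw'0 k) hw'1 fun k _ => hSP (hz k)
  have hcomb : ε • y + (1 - ε) • y' = ∑ k, w k • z k := by
    have : (1 - ε) • y' = ∑ k, (w k - ε * ((if k = i then α else 0) + if k = j then β else 0)) • z k := by
      rw [hy', Finset.smul_sum]
      refine Finset.sum_congr rfl fun k _ => ?_
      rw [smul_smul, hw', mul_inv_cancel_left₀ hne]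
    rw [this]
    simp only [sub_smul, mul_smul, add_smul, Finset.sum_sub_distrib, ← Finset.smul_sum,
      Finset.sum_add_distrib, ite_smul, zero_smul, Finset.sum_ite_eq', Finset.mem_univ, if_true]
    rw [hy]
    abel
  have hfy' : f y' = 0 := by
    have h := congrArg f hcomb
    rw [Convex.combo_affine_apply (by ring), hfx, hfy] at h
    simpa [hne] using h
  have hyx := hx.2 ⟨hyP, hfy.ge⟩ ⟨hy'P, hfy'.ge⟩
    ⟨ε, 1 - ε, hε0, by linarith, by ring, hcomb⟩
  exact ⟨α, β, hα0, hβ0, hαβ, hyx⟩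

/-- A vertex of a halfspace section in the open halfspace is a vertex of the original set. -/
theorem mem_extremePoints_of_mem_extremePoints_inter {P : Set E} (hP : Convex ℝ P)
    (f : E →ᵃ[ℝ] ℝ) {x : E} (hx : x ∈ (P ∩ {y | 0 ≤ f y}).extremePoints ℝ) (hfx : 0 < f x) :
    x ∈ P.extremePoints ℝ := by
  refine ⟨hx.1.1, fun a ha b hb hab => ?_⟩
  obtain ⟨p, q, hp, hq, hpq, hx'⟩ := hab
  -- Contract `a` and `b` towards `x` by a factor `t` so small that the images stay in the
  -- halfspace; there extremality of `x` applies.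
  set M := 1 + |f a| + |f b| with hM
  have hM1 : 0 < M := by positivity
  set t := min (f x / (f x + M)) 1 with ht
  have ht0 : 0 < t := by positivity
  have ht1 : t ≤ 1 := min_le_right _ _
  have htM : t * M ≤ (1 - t) * f x := by
    have h : t ≤ f x / (f x + M) := min_le_left _ _
    rw [le_div_iff₀ (by positivity)] at h
    linarith
  have mem : ∀ c ∈ P, |f c| ≤ M → t • c + (1 - t) • x ∈ P ∩ {y | 0 ≤ f y} := fun c hc hcM => by
    refine ⟨hP hc hx.1.1 ht0.le (by linarith) (by ring), ?_⟩
    change 0 ≤ f _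
    rw [Convex.combo_affine_apply (by ring)]
    simp only [smul_eq_mul]
    have := neg_abs_le (f c)
    nlinarith
  have h := hx.2 (mem a ha (by have := abs_nonneg (f b); linarith))
    (mem b hb (by have := abs_nonneg (f a); linarith)) ⟨p, q, hp, hq, hpq, by
      calc p • (t • a + (1 - t) • x) + q • (t • b + (1 - t) • x)
          = t • (p • a + q • b) + ((p + q) * (1 - t)) • x := by module
        _ = x := by rw [hx', hpq]; module⟩
  have h2 : t • (a - x) = 0 := by
    rw [← sub_eq_zero] at h
    rw [← h]; module
  exact sub_eq_zero.1 ((smul_eq_zero.1 h2).resolve_left ht0.ne')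

/-- An affine function with distinct end values is injective on the segment. Hence each pair of old
vertices on opposite sides yields at most one new vertex. -/
theorem eq_of_mem_openSegment_of_affine_eq {f : E →ᵃ[ℝ] ℝ} {u v x y : E} (huv : f u ≠ f v)
    (hx : x ∈ openSegment ℝ u v) (hy : y ∈ openSegment ℝ u v) (h : f x = f y) : x = y := by
  obtain ⟨a, b, -, -, hab, rfl⟩ := hx
  obtain ⟨a', b', -, -, hab', rfl⟩ := hy
  rw [Convex.combo_affine_apply hab, Convex.combo_affine_apply hab'] at h
  simp only [smul_eq_mul] at h
  obtain rfl : a = 1 - b := by linarith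
  obtain rfl : a' = 1 - b' := by linarith
  have : (b - b') * (f v - f u) = 0 := by linarith
  have hb := (mul_eq_zero.1 this).resolve_right (sub_ne_zero.2 huv.symm)
  rw [sub_eq_zero.1 hb]

end HalfspaceCut

/-! ### Faces of a simplex in barycentric coordinates. -/

theorem AffineBasis.mem_convexHull_image_iff {ι E : Type*} [Fintype ι] [AddCommGroup E] [Module ℝ E]
    (b : AffineBasis ι ℝ E) (s : Set ι) (x : E) :
    x ∈ convexHull ℝ (b '' s) ↔ x ∈ convexHull ℝ (Set.range b) ∧ ∀ i ∉ s, b.coord i x = 0 := by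
  classical
  constructor
  · refine fun h => ⟨convexHull_mono (Set.image_subset_range _ _) h, fun i hi => ?_⟩
    have hsub : convexHull ℝ (b '' s) ⊆ {y | b.coord i y = 0} := by
      refine convexHull_min ?_ ?_
      · rintro _ ⟨j, hj, rfl⟩
        exact b.coord_apply_ne (by rintro rfl; exact hi hj)
      · exact (convex_singleton (0 : ℝ)).affine_preimage (b.coord i)
    exact hsub h
  · rintro ⟨h, h0⟩
    rw [b.convexHull_eq_nonneg_coord] at h
    rw [← b.linear_combination_coord_eq_self x]
    have hsum : ∀ {M : Type _} [AddCommMonoid M] (g : ι → M), (∀ i ∉ s, g i = 0) →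
        ∑ i, g i = ∑ i with i ∈ s, g i := fun g hg =>
      (Finset.sum_filter_of_ne fun i _ hi => by_contra fun h => hi (hg i h)).symm
    rw [hsum _ fun i hi => by rw [h0 i hi, zero_smul]]
    refine (convex_convexHull ℝ _).sum_mem (fun i _ => h i) ?_
      fun i hi => subset_convexHull ℝ _ ⟨i, (Finset.mem_filter.1 hi).2, rfl⟩
    rw [← b.sum_coord_apply_eq_one x]
    exact (Finset.sum_filter_of_ne fun i _ hi => by_contra fun h => hi (h0 i h))

theorem AffineBasis.isExtreme_convexHull_image {ι E : Type*} [Fintype ι] [AddCommGroup E]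
    [Module ℝ E] (b : AffineBasis ι ℝ E) (s : Set ι) :
    IsExtreme ℝ (convexHull ℝ (Set.range b)) (convexHull ℝ (b '' s)) := by
  refine ⟨convexHull_mono (Set.image_subset_range _ _), fun x hx y hy z hz hxyz => ?_⟩
  rw [b.mem_convexHull_image_iff] at hz ⊢
  refine ⟨hx, fun i hi => ?_⟩
  have h := hz.2 i hi
  obtain ⟨p, q, hp, hq, hpq, rfl⟩ := hxyz
  rw [b.convexHull_eq_nonneg_coord] at hx hy
  rw [Convex.combo_affine_apply hpq] at h
  simp only [smul_eq_mul] at h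
  have h1 := mul_nonneg hp.le (hx i)
  have h2 := mul_nonneg hq.le (hy i)
  exact (mul_eq_zero.1 (show p * b.coord i x = 0 by linarith)).resolve_left hp.ne'
-- The invariant, the simplex, and change of realization.
namespace TippedPolytope

variable {d : ℕ}

/-- The largest label missing at the vertices of the `i`-th tip. -/
def maxMissing (m i : ℕ) : ℕ := if i = 0 then m + 2 else if i = 1 then m + 1 else m + i + 1

/-- The properties of the realizations of the `m`-th combinatorial type. -/
structure Regular (m : ℕ) (Q : TippedPolytope d) : Prop where
  compact : IsCompact Q.carrier
  convex : Convex ℝ Q.carrier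
  finite : (vert Q.carrier).Finite
  facet_extreme : ∀ k ∈ Set.Icc 1 (m + d + 1), IsExtreme ℝ Q.carrier (Q.facet k)
  facet_convex : ∀ k ∈ Set.Icc 1 (m + d + 1), Convex ℝ (Q.facet k)
  tip_subset : ∀ i ≤ d, Q.tip i ⊆ vert Q.carrier
  isGreatest : ∀ i ≤ d, ∀ v ∈ Q.tip i,
    IsGreatest (Set.Icc 1 (m + d + 1) \ Q.label (m + d + 1) v) (maxMissing m i)
  exists_tip : ∀ v ∈ vert Q.carrier, ∃ i ≤ d, v ∈ Q.tip i

theorem maxMissing_injective (m : ℕ) : Function.Injective (maxMissing m) := by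
  intro i j h
  unfold maxMissing at h
  split_ifs at h <;> omega

theorem Regular.mem_tip_iff {m : ℕ} {Q : TippedPolytope d} (hQ : Regular m Q) {v : Space d}
    (hv : v ∈ vert Q.carrier) {i : ℕ} (hi : i ≤ d) :
    v ∈ Q.tip i ↔ IsGreatest (Set.Icc 1 (m + d + 1) \ Q.label (m + d + 1) v) (maxMissing m i) := by
  refine ⟨hQ.isGreatest i hi v, fun h => ?_⟩
  obtain ⟨j, hj, hvj⟩ := hQ.exists_tip v hv
  rwa [maxMissing_injective m (h.unique (hQ.isGreatest j hj v hvj))]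

/-- Krein–Milman; the closure is superfluous because there are finitely many vertices. -/
theorem Regular.carrier_eq {m : ℕ} {Q : TippedPolytope d} (hQ : Regular m Q) :
    Q.carrier = convexHull ℝ (vert Q.carrier) := by
  rw [← (hQ.finite.isClosed_convexHull ℝ).closure_eq]
  exact (closure_convexHull_extremePoints hQ.compact hQ.convex).symm

theorem Regular.simplex (hd : 2 ≤ d) (v : Fin (d + 1) → Space d) (hv : AffineIndependent ℝ v) :
    Regular 0 (simplex v) := by
  have htop : affineSpan ℝ (Set.range v) = ⊤ := by
    rw [hv.affineSpan_eq_top_iff_card_eq_finrank_add_one]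
    simp
  let b : AffineBasis (Fin (d + 1)) ℝ (Space d) := ⟨v, hv, htop⟩
  have hmem : ∀ (s : Set (Fin (d + 1))) i, v i ∈ convexHull ℝ (v '' s) ↔ i ∈ s := fun s i => by
    refine ⟨fun h => ?_, fun h => subset_convexHull ℝ _ ⟨i, h, rfl⟩⟩
    by_contra hi
    have h0 : b.coord i (b i) = 0 := ((b.mem_convexHull_image_iff s (v i)).1 h).2 i hi
    rw [b.coord_apply_eq] at h0
    exact one_ne_zero h0
  have hvert : ∀ i, v i ∈ vert (convexHull ℝ (Set.range v)) := fun i => by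
    have h := b.isExtreme_convexHull_image {i}
    rw [Set.image_singleton, convexHull_singleton, isExtreme_singleton] at h
    exact h
  refine ⟨(Set.finite_range v).isCompact_convexHull ℝ, convex_convexHull ℝ _,
    (Set.finite_range v).subset extremePoints_convexHull_subset,
    fun k _ => b.isExtreme_convexHull_image _, fun k _ => convex_convexHull ℝ _, ?_, ?_, ?_⟩
  · rintro i - _ ⟨h, rfl⟩
    exact hvert _
  · rintro i hi _ ⟨h, rfl⟩
    -- Each vertex of the simplex misses a single facet; the swap of labels 1 and 2 is what makes
    -- the cases `i = 0, 1` exceptional.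
    have hval : Equiv.swap 1 2 (i + 1) = maxMissing 0 i := by
      simp only [Equiv.swap_apply_def, maxMissing]
      split_ifs <;> omega
    have hset : Set.Icc 1 (0 + d + 1) \ (TippedPolytope.simplex v).label (0 + d + 1) (v ⟨i, h⟩) =
        {maxMissing 0 i} := by
      ext k
      simp only [label, TippedPolytope.simplex, hmem, Set.mem_sdiff, Set.mem_ofPred_eq, hval,
        Set.mem_singleton_iff, not_and, not_not]
      refine ⟨fun h => (h.2 h.1).symm, ?_⟩
      rintro rfl
      refine ⟨?_, fun _ => rfl⟩
      unfold maxMissing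
      rw [Set.mem_Icc]
      split_ifs <;> omega
    rw [hset]
    exact isGreatest_singleton
  · intro x hx
    obtain ⟨i, rfl⟩ := extremePoints_convexHull_subset hx
    exact ⟨i, Nat.lt_succ_iff.1 i.2, i.2, rfl⟩

theorem Regular.sameType {m : ℕ} {Q Q' : TippedPolytope d} (hQ : Regular m Q)
    {φ : vert Q.carrier ≃ vert Q'.carrier} (h : SameType (m + d + 1) Q Q' φ) : Regular m Q' := by
  obtain ⟨s, hs, hcar⟩ := h.polytope
  have hconv : Convex ℝ Q'.carrier := hcar ▸ convex_convexHull ℝ s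
  refine ⟨hcar ▸ (hs.isCompact_convexHull ℝ), hconv, ?_,
    fun k hk => IsExposed.isExtreme (h.facet_face k hk),
    fun k hk => IsExposed.convex (h.facet_face k hk) hconv, h.tip_subset, fun i hi v hv => ?_,
    fun v hv => ?_⟩
  · rw [hcar]
    exact hs.subset extremePoints_convexHull_subset
  · obtain ⟨u, hu⟩ := φ.surjective ⟨v, h.tip_subset i hi hv⟩
    obtain rfl : (φ u : Space d) = v := congrArg Subtype.val hu
    have hlabel : Q'.label (m + d + 1) (φ u) = Q.label (m + d + 1) u := by
      ext k
      exact and_congr_right fun hk => h.facet_iff k hk u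
    rw [hlabel]
    exact hQ.isGreatest i hi u ((h.tip_iff i hi u).1 hv)
  · obtain ⟨u, hu⟩ := φ.surjective ⟨v, hv⟩
    obtain rfl : (φ u : Space d) = v := congrArg Subtype.val hu
    obtain ⟨i, hi, hui⟩ := hQ.exists_tip u u.2
    exact ⟨i, hi, (h.tip_iff i hi u).2 hui⟩

/-! ### Vertices and missing labels after a cut. -/

section Cut

variable {m : ℕ} {Q : TippedPolytope d} {H : OrientedHyperplane d}

theorem Separates.pos_of_even (hH : Q.Separates H) {i : ℕ} (hi : i ≤ d) (he : Even i)
    {v : Space d} (hv : v ∈ Q.tip i) : 0 < H.functional v :=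
  hH.1 (Set.mem_biUnion (show i ∈ {i : ℕ | i ≤ d ∧ Even i} from ⟨hi, he⟩) hv)

theorem Separates.neg_of_odd (hH : Q.Separates H) {i : ℕ} (hi : i ≤ d) (ho : Odd i)
    {v : Space d} (hv : v ∈ Q.tip i) : H.functional v < 0 :=
  hH.2 (Set.mem_biUnion (show i ∈ {i : ℕ | i ≤ d ∧ Odd i} from ⟨hi, ho⟩) hv)

theorem Separates.functional_ne_zero (hH : Q.Separates H) {i : ℕ} (hi : i ≤ d)
    {v : Space d} (hv : v ∈ Q.tip i) : H.functional v ≠ 0 := by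
  rcases Nat.even_or_odd i with h | h
  · exact (hH.pos_of_even hi h hv).ne'
  · exact (hH.neg_of_odd hi h hv).ne

theorem Separates.even_of_pos (hH : Q.Separates H) {i : ℕ} (hi : i ≤ d)
    {v : Space d} (hv : v ∈ Q.tip i) (h : 0 < H.functional v) : Even i := by
  by_contra ho
  exact h.not_gt (hH.neg_of_odd hi (Nat.not_even_iff_odd.1 ho) hv)

theorem Separates.odd_of_neg (hH : Q.Separates H) {i : ℕ} (hi : i ≤ d)
    {v : Space d} (hv : v ∈ Q.tip i) (h : H.functional v < 0) : Odd i := by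
  by_contra he
  exact h.not_gt (hH.pos_of_even hi (Nat.not_odd_iff_even.1 he) hv)

/-- A vertex of the cut polytope on the hyperplane that is a convex combination of points of tips
lies between a point of an even tip and a point of an odd tip among these. -/
theorem Regular.exists_mem_openSegment (hQ : Regular m Q) (hH : Q.Separates H) {S : Set (Space d)}
    (hS : ∀ y ∈ S, ∃ i ≤ d, y ∈ Q.tip i) {x : Space d} (hx : x ∈ vert (Q.cutCarrier H))
    (hfx : H.functional x = 0) (hxS : x ∈ convexHull ℝ S) :
    ∃ u ∈ S, ∃ v ∈ S, 0 < H.functional u ∧ H.functional v < 0 ∧ x ∈ openSegment ℝ u v := by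
  refine exists_mem_openSegment_of_mem_extremePoints_inter hQ.convex (fun y hy => ?_) H.functional
    (fun y hy => ?_) hx hfx hxS
  · obtain ⟨i, hi, hyi⟩ := hS y hy
    exact (hQ.tip_subset i hi hyi).1
  · obtain ⟨i, hi, hyi⟩ := hS y hy
    exact hH.functional_ne_zero hi hyi

theorem Regular.missing_of_mem_openSegment (hQ : Regular m Q) {u v x : Space d}
    (hu : u ∈ Q.carrier) (hv : v ∈ Q.carrier) (hx : x ∈ vert (Q.cutCarrier H))
    (hfx : H.functional x = 0) (hxuv : x ∈ openSegment ℝ u v) :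
    Set.Icc 1 (m + 1 + d + 1) \ (cut (m + d + 1) Q H).label (m + 1 + d + 1) x =
      (Set.Icc 1 (m + d + 1) \ Q.label (m + d + 1) u) ∪
        (Set.Icc 1 (m + d + 1) \ Q.label (m + d + 1) v) := by
  have hfacet : ∀ k ∈ Set.Icc 1 (m + d + 1), x ∈ Q.facet k ↔ u ∈ Q.facet k ∧ v ∈ Q.facet k :=
    fun k hk => ⟨fun h =>
      ⟨(hQ.facet_extreme k hk).left_mem_of_mem_openSegment hu hv h hxuv,
        (hQ.facet_extreme k hk).right_mem_of_mem_openSegment hu hv h hxuv⟩,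
      fun h => (hQ.facet_convex k hk).openSegment_subset h.1 h.2 hxuv⟩
  ext k
  -- The new label is present at `x`, which lies on the hyperplane, so only old labels can be
  -- missing.
  by_cases hk : k = m + d + 1 + 1
  · subst hk
    have hmem : x ∈ (cut (m + d + 1) Q H).facet (m + d + 1 + 1) := by
      simp only [cut, if_true]
      exact ⟨hx.1.1, hfx⟩
    have h1 : m + d + 1 + 1 ∉ Set.Icc 1 (m + d + 1) := by simp
    simp only [Set.mem_sdiff, Set.mem_union, label, Set.mem_ofPred_eq, hmem, h1]
    tauto
  · have hIcc : k ∈ Set.Icc 1 (m + 1 + d + 1) ↔ k ∈ Set.Icc 1 (m + d + 1) := by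
      simp only [Set.mem_Icc]
      omega
    have hmem : x ∈ (cut (m + d + 1) Q H).facet k ↔ x ∈ Q.facet k := by
      simp only [cut, if_neg hk]
      exact and_iff_left hx.1
    simp only [Set.mem_sdiff, Set.mem_union, label, Set.mem_ofPred_eq, hmem, hIcc]
    have := hfacet k
    tauto

theorem Regular.isGreatest_of_mem_openSegment (hQ : Regular m Q) {u v x : Space d} {i j : ℕ}
    (hi : i ≤ d) (hj : j ≤ d) (hu : u ∈ Q.tip i) (hv : v ∈ Q.tip j)
    (hx : x ∈ vert (Q.cutCarrier H)) (hfx : H.functional x = 0) (hxuv : x ∈ openSegment ℝ u v) :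
    IsGreatest (Set.Icc 1 (m + 1 + d + 1) \ (cut (m + d + 1) Q H).label (m + 1 + d + 1) x)
      (max (maxMissing m i) (maxMissing m j)) := by
  rw [hQ.missing_of_mem_openSegment (hQ.tip_subset i hi hu).1 (hQ.tip_subset j hj hv).1 hx hfx hxuv]
  exact (hQ.isGreatest i hi u hu).union (hQ.isGreatest j hj v hv)

theorem Regular.functional_vert (hQ : Regular m Q) (hH : Q.Separates H) {x : Space d}
    (hx : x ∈ vert Q.carrier) : H.functional x ≠ 0 := by
  obtain ⟨i, hi, hxi⟩ := hQ.exists_tip x hx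
  exact hH.functional_ne_zero hi hxi

/-- The vertices of the cut polytope are vertices of the original polytope or lie on the hyperplane,
between two vertices on different sides. -/
theorem Regular.vert_cut (hQ : Regular m Q) (hH : Q.Separates H) {x : Space d}
    (hx : x ∈ vert (Q.cutCarrier H)) :
    (x ∈ vert Q.carrier ∧ 0 < H.functional x) ∨ (H.functional x = 0 ∧
      ∃ u ∈ vert Q.carrier, ∃ v ∈ vert Q.carrier,
        0 < H.functional u ∧ H.functional v < 0 ∧ x ∈ openSegment ℝ u v) := by
  have hnn : 0 ≤ H.functional x := hx.1.2
  rcases hnn.eq_or_lt with h | h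
  · refine Or.inr ⟨h.symm, hQ.exists_mem_openSegment hH hQ.exists_tip hx h.symm ?_⟩
    rw [← hQ.carrier_eq]
    exact hx.1.1
  · exact Or.inl ⟨mem_extremePoints_of_mem_extremePoints_inter hQ.convex H.functional hx h, h⟩

theorem Regular.finite_vert_cut (hQ : Regular m Q) (hH : Q.Separates H) :
    (vert (Q.cutCarrier H)).Finite := by
  have hfin : (⋃ u ∈ vert Q.carrier, ⋃ v ∈ vert Q.carrier, {x | H.functional x = 0 ∧
      0 < H.functional u ∧ H.functional v < 0 ∧ x ∈ openSegment ℝ u v}).Finite :=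
    hQ.finite.biUnion fun u _ => hQ.finite.biUnion fun v _ => Set.Subsingleton.finite
      fun x hx y hy => eq_of_mem_openSegment_of_affine_eq (hx.2.2.1.trans hx.2.1).ne'
        hx.2.2.2 hy.2.2.2 (hx.1.trans hy.1.symm)
  refine (hQ.finite.union hfin).subset fun x hx => ?_
  rcases hQ.vert_cut hH hx with h | ⟨h0, u, hu, v, hv, h⟩
  · exact Or.inl h.1
  · exact Or.inr (Set.mem_biUnion hu (Set.mem_biUnion hv ⟨h0, h⟩))

theorem isGreatest_of_functional_ne_zero (hd : 2 ≤ d) {x : Space d}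
    (hfx : H.functional x ≠ 0) :
    IsGreatest (Set.Icc 1 (m + 1 + d + 1) \ (cut (m + d + 1) Q H).label (m + 1 + d + 1) x)
      (maxMissing (m + 1) d) := by
  have hval : maxMissing (m + 1) d = m + 1 + d + 1 := by
    unfold maxMissing
    split_ifs <;> omega
  rw [hval]
  refine ⟨⟨⟨by omega, le_rfl⟩, fun h => hfx ?_⟩, fun k hk => hk.1.2⟩
  have h2 := h.2
  simp only [cut, show m + 1 + d + 1 = m + d + 1 + 1 by omega, if_true] at h2
  exact h2.2

/-! ### Index arithmetic of the new tips. -/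

theorem cut_tip_last (hd : 2 ≤ d) :
    (cut (m + d + 1) Q H).tip d = ⋃ k ∈ {k : ℕ | k ≤ d / 2}, Q.tip (2 * k) := by
  change Q.cutTip H d = _
  unfold cutTip
  rw [if_neg (by omega), if_neg (by omega), if_neg (lt_irrefl d), if_pos rfl]

/-- The tips whose points span the `j`-th tip after a cut, for `j < d`. -/
def tipIndices (j : ℕ) : Set ℕ :=
  if j = 0 then {1, 2} else if j = 1 then {0, 1} else insert (j + 1) {k | k ≤ j ∧ Even (k + j)}

theorem cut_tip_of_lt {n j : ℕ} (hj : j < d) :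
    (cut n Q H).tip j = Q.newVertices H (⋃ k ∈ tipIndices j, Q.tip k) := by
  change Q.cutTip H j = _
  unfold cutTip tipIndices
  split_ifs <;> simp only [Set.biUnion_insert, Set.biUnion_singleton]

theorem tipIndices_le (hd : 2 ≤ d) {j k : ℕ} (hj : j < d) (hk : k ∈ tipIndices j) : k ≤ d := by
  unfold tipIndices at hk
  split_ifs at hk <;>
    simp only [Set.mem_insert_iff, Set.mem_singleton_iff, Set.mem_ofPred_eq] at hk <;> omega

/-- For `j ≥ 2`, all indices other than `j + 1` have the parity of `j`, so opposite parities force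
one of `a`, `b` to be `j + 1`, the larger one. -/
theorem max_maxMissing {m j a b : ℕ} (ha : a ∈ tipIndices j) (hb : b ∈ tipIndices j)
    (hea : Even a) (hob : Odd b) :
    max (maxMissing m a) (maxMissing m b) = maxMissing (m + 1) j := by
  rw [Nat.even_iff] at hea
  rw [Nat.odd_iff] at hob
  unfold tipIndices at ha hb
  split_ifs at ha hb with h0 h1 <;>
    simp only [Set.mem_insert_iff, Set.mem_singleton_iff, Set.mem_ofPred_eq, Nat.even_iff] at ha hb
  · obtain rfl : a = 2 := by omega
    obtain rfl : b = 1 := by omega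
    subst h0
    simp [maxMissing]
  · obtain rfl : a = 0 := by omega
    obtain rfl : b = 1 := by omega
    subst h1
    simp [maxMissing]
  · unfold maxMissing
    split_ifs <;> omega

/-- The larger index determines `j`: 1 gives 1, 2 gives 0, and any larger value `M` gives `M - 1`,
whose parity the smaller index shares. -/
theorem exists_tipIndices {a b : ℕ} (ha : a ≤ d) (hb : b ≤ d) (hd : 4 ≤ d) (hea : Even a)
    (hob : Odd b) : ∃ j < d, a ∈ tipIndices j ∧ b ∈ tipIndices j := by
  rw [Nat.even_iff] at hea
  rw [Nat.odd_iff] at hob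
  have hmem : ∀ j k, k ∈ tipIndices j ↔ (j = 0 ∧ (k = 1 ∨ k = 2)) ∨ (j = 1 ∧ (k = 0 ∨ k = 1)) ∨
      (2 ≤ j ∧ (k = j + 1 ∨ (k ≤ j ∧ (k + j) % 2 = 0))) := by
    intro j k
    unfold tipIndices
    split_ifs <;>
      simp only [Set.mem_insert_iff, Set.mem_singleton_iff, Set.mem_ofPred_eq, Nat.even_iff] <;> omega
  simp only [hmem]
  by_cases h1 : max a b = 1
  · exact ⟨1, by omega, by omega, by omega⟩
  by_cases h2 : max a b = 2
  · exact ⟨0, by omega, by omega, by omega⟩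
  exact ⟨max a b - 1, by omega, by omega, by omega⟩

theorem Regular.cut (hQ : Regular m Q) (hd : 4 ≤ d) (hd_even : Even d) (hH : Q.Separates H) :
    Regular (m + 1) (cut (m + d + 1) Q H) := by
  have hle : ∀ k ∈ {k : ℕ | k ≤ d / 2}, 2 * k ≤ d := fun k hk => by
    have : k ≤ d / 2 := hk
    omega
  have hHnn : H.nonneg = H.functional ⁻¹' Set.Ici 0 := rfl
  have hconv : Convex ℝ (Q.cutCarrier H) :=
    hQ.convex.inter ((convex_Ici (0 : ℝ)).affine_preimage H.functional)
  have hplane : IsExtreme ℝ (Q.cutCarrier H) (Q.carrier ∩ H.plane) := by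
    refine ⟨fun x hx => ⟨hx.1, (show H.functional x = 0 from hx.2).ge⟩,
      fun x hx y hy z hz hxyz => ⟨hx.1, ?_⟩⟩
    obtain ⟨p, q, hp, hq, hpq, rfl⟩ := hxyz
    have h : H.functional _ = 0 := hz.2
    rw [Convex.combo_affine_apply hpq] at h
    simp only [smul_eq_mul] at h
    have h1 := mul_nonneg hp.le (show 0 ≤ H.functional x from hx.2)
    have h2 := mul_nonneg hq.le (show 0 ≤ H.functional y from hy.2)
    exact (mul_eq_zero.1 (show p * H.functional x = 0 by linarith)).resolve_left hp.ne'
  have hIcc : ∀ k ∈ Set.Icc 1 (m + 1 + d + 1), k ≠ m + d + 1 + 1 → k ∈ Set.Icc 1 (m + d + 1) :=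
    fun k hk hne => by
      simp only [Set.mem_Icc] at hk ⊢
      omega
  refine ⟨?_, hconv, hQ.finite_vert_cut hH, fun k hk => ?_, fun k hk => ?_, fun i hi x hx => ?_,
    fun i hi x hx => ?_, fun x hx => ?_⟩
  · refine hQ.compact.inter_right ?_
    rw [hHnn]
    exact isClosed_Ici.preimage H.functional.continuous_of_finiteDimensional
  · by_cases h : k = m + d + 1 + 1
    · simpa only [TippedPolytope.cut, if_pos h] using hplane
    · simp only [TippedPolytope.cut, if_neg h]
      refine ⟨Set.inter_subset_right, fun x hx y hy z hz hxyz => ⟨?_, hx⟩⟩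
      exact (hQ.facet_extreme k (hIcc k hk h)).left_mem_of_mem_openSegment hx.1 hy.1 hz.1 hxyz
  · by_cases h : k = m + d + 1 + 1
    · simp only [TippedPolytope.cut, if_pos h]
      exact hQ.convex.inter ((convex_singleton (0 : ℝ)).affine_preimage H.functional)
    · simp only [TippedPolytope.cut, if_neg h]
      exact (hQ.facet_convex k (hIcc k hk h)).inter hconv
  · rcases hi.eq_or_lt with rfl | hlt
    · rw [cut_tip_last (by omega)] at hx
      obtain ⟨k, hk, hxk⟩ := Set.mem_iUnion₂.1 hx
      exact inter_extremePoints_subset_extremePoints_of_subset Set.inter_subset_left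
        ⟨⟨(hQ.tip_subset _ (hle k hk) hxk).1,
          (hH.pos_of_even (hle k hk) (even_two_mul k) hxk).le⟩, hQ.tip_subset _ (hle k hk) hxk⟩
    · rw [cut_tip_of_lt hlt] at hx
      exact hx.1
  · rcases hi.eq_or_lt with rfl | hlt
    · rw [cut_tip_last (by omega)] at hx
      obtain ⟨k, hk, hxk⟩ := Set.mem_iUnion₂.1 hx
      exact isGreatest_of_functional_ne_zero (by omega) (hH.functional_ne_zero (hle k hk) hxk)
    · rw [cut_tip_of_lt hlt] at hx
      obtain ⟨hxv, hxc, hx0⟩ := hx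
      obtain ⟨u, hu, v, hv, hfu, hfv, hxuv⟩ := hQ.exists_mem_openSegment hH (fun y hy => by
        obtain ⟨k, hk, hyk⟩ := Set.mem_iUnion₂.1 hy
        exact ⟨k, tipIndices_le (by omega) hlt hk, hyk⟩) hxv hx0 hxc
      obtain ⟨a, ha, hua⟩ := Set.mem_iUnion₂.1 hu
      obtain ⟨b, hb, hvb⟩ := Set.mem_iUnion₂.1 hv
      have had := tipIndices_le (by omega) hlt ha
      have hbd := tipIndices_le (by omega) hlt hb
      rw [← max_maxMissing ha hb (hH.even_of_pos had hua hfu) (hH.odd_of_neg hbd hvb hfv)]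
      exact hQ.isGreatest_of_mem_openSegment had hbd hua hvb hxv hx0 hxuv
  · rcases hQ.vert_cut hH hx with ⟨hxv, hfx⟩ | ⟨hx0, u, hu, v, hv, hfu, hfv, hxuv⟩
    · refine ⟨d, le_rfl, ?_⟩
      obtain ⟨i, hi, hxi⟩ := hQ.exists_tip x hxv
      obtain ⟨k, rfl⟩ := (hH.even_of_pos hi hxi hfx).two_dvd
      rw [cut_tip_last (by omega)]
      exact Set.mem_biUnion (show k ≤ d / 2 by omega) hxi
    · obtain ⟨a, ha, hua⟩ := hQ.exists_tip u hu
      obtain ⟨b, hb, hvb⟩ := hQ.exists_tip v hv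
      obtain ⟨j, hj, haj, hbj⟩ := exists_tipIndices ha hb hd (hH.even_of_pos ha hua hfu)
        (hH.odd_of_neg hb hvb hfv)
      refine ⟨j, hj.le, ?_⟩
      rw [cut_tip_of_lt hj]
      exact ⟨hx, segment_subset_convexHull (Set.mem_biUnion haj hua) (Set.mem_biUnion hbj hvb)
        (openSegment_subset_segment ℝ u v hxuv), hx0⟩

end Cut

/-! ### Induction over the construction and conclusion. -/

theorem Realizes.regular (hd : 4 ≤ d) (hd_even : Even d) {m : ℕ} {Q : TippedPolytope d}
    (hQ : Realizes m Q) : Regular m Q := by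
  induction hQ with
  | simplex v hv => exact Regular.simplex (by omega) v hv
  | cut m Q H _ hH ih => exact ih.cut hd hd_even hH
  | sameType m Q Q' φ _ hφ ih => exact ih.sameType hφ

end TippedPolytope

theorem proposition3p7 (d : ℕ) (hd : 4 ≤ d) (hd_even : Even d) (m n : ℕ) (hn : n = m + d + 1)
    (Q : TippedPolytope d) (hQ : TippedPolytope.Realizes m Q)
    (v : Space d) (hv : v ∈ vert Q.carrier) (i : ℕ) (hi : i ≤ d) :
    v ∈ Q.tip i ↔
      IsGreatest (Set.Icc 1 n \ Q.label n v)
        (if i = 0 then m + 2 else if i = 1 then m + 1 else m + i + 1) := by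
  subst hn
  exact (hQ.regular hd hd_even).mem_tip_iff hv hi
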